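/- Let $d\ge 0$ be an integer and let $$\mathcal S_d=\{Z=X+iY\in\mathbb C^{d\times d}:\ X,Y \text{ real},\ X^t=X,\ Y^t=Y,\ Y>0\}$$ be the Siegel upper half space. For $Z=X+iY\in\mathcal S_d$ and $W\in\mathbb C^{d\times d}$ put $F_Z(W)=\|Y^{-1/2}WY^{-1/2}\|$, where $\|\cdot\|$ is the operator norm of matrices acting on Euclidean $\mathbb C^d$, and for $Z_1,Z_2\in\mathcal S_d$ put $$d_\infty(Z_1,Z_2)=\inf_{Z(\cdot)}\int_0^1F_{Z(t)}(\dot Z(t))\,dt ,$$ the infimum being over all differentiable paths $Z:[0,1]\to\mathcal S_d$ with $Z(0)=Z_1$, $Z(1)=Z_2$ for which $t\mapsto F_{Z(t)}(\dot Z(t))$ is integrable. Let $(B(n))_{n\ge 0}$ be a sequence of real symmetric $d\times d$ matrices and, for $z\in\mathbb C$, let $$T_-(n,z)=\begin{pmatrix} zI-B(n) & -I\\ I & 0\end{pmatrix}$$ be the transfer matrices of the discrete Schrödinger equation $y(n+1)+y(n-1)+B(n)y(n)=zy(n)$. A matrix $T=\begin{pmatrix}A&B\\C&D\end{pmatrix}$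 with $d\times d$ blocks acts by the matrix fractional linear map $T(Z)=(AZ+B)(CZ+D)^{-1}$ wherever $CZ+D$ is invertible. **Theorem.** Let $z\in\mathbb C$ with $y=\operatorname{Im}z>0$, let $Z_1,Z_2\in\mathcal S_d$ and put $W_j=T_-(0,z)(Z_j)$ for $j=1,2$. Then $W_1,W_2$ are well defined and lie in $\mathcal S_d$, and for every integer $n\ge 0$ the matrices $T_-(n,z)(W_1)$ and $T_-(n,z)(W_2)$ are well defined, lie in $\mathcal S_d$, and satisfy $$d_\infty\bigl(T_-(n,z)(W_1),\,T_-(n,z)(W_2)\bigr)\le\frac{1}{1+y^2}\,d_\infty(W_1,W_2).$$ -/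

import Mathlib

open Matrix
open scoped Matrix.Norms.L2Operator MatrixOrder ComplexOrder

noncomputable section

namespace Siegel

variable {d : ℕ}

/-- The entrywise imaginary part `Y` of a complex matrix `Z = X + i Y`, where `X` and `Y` are real
matrices, regarded again as a matrix with complex entries. -/
def imPart (Z : Matrix (Fin d) (Fin d) ℂ) : Matrix (Fin d) (Fin d) ℂ :=
  (Z.map Complex.im).map Complex.ofReal

/-- The Siegel upper half space `S_d`: all `Z = X + i Y` with `X` and `Y` real symmetric `d × d`
matrices and `Y` positive definite. -/
def upperHalfSpace (d : ℕ) : Set (Matrix (Fin d) (Fin d) ℂ) :=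
  {Z | (Z.map Complex.re)ᵀ = Z.map Complex.re ∧ (Z.map Complex.im)ᵀ = Z.map Complex.im ∧
    (Z.map Complex.im).PosDef}

/-- The matrix `Y^{-1/2} = (Y^{1/2})⁻¹`, where `Y` is the imaginary part of `Z` and `Y^{1/2}` is
its positive semidefinite square root. -/
def invSqrtIm (Z : Matrix (Fin d) (Fin d) ℂ) : Matrix (Fin d) (Fin d) ℂ :=
  (CFC.sqrt (imPart Z))⁻¹

/-- The Finsler norm `F_Z(W) = ‖Y^{-1/2} W Y^{-1/2}‖` of a tangent vector `W` at `Z`. The norm is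
the operator norm of matrices acting on `ℂ^d` with its Euclidean norm. -/
def finslerNorm (Z W : Matrix (Fin d) (Fin d) ℂ) : ℝ :=
  ‖invSqrtIm Z * W * invSqrtIm Z‖

/-- `γ` restricted to `[0, 1]` is a differentiable path in the Siegel upper half space from `Z₁`
to `Z₂` (one-sided derivatives at the end points) whose Finsler speed is integrable, so that its
length is defined. -/
structure IsPath (Z₁ Z₂ : Matrix (Fin d) (Fin d) ℂ) (γ : ℝ → Matrix (Fin d) (Fin d) ℂ) : Prop where
  source : γ 0 = Z₁
  target : γ 1 = Z₂
  mem : ∀ t ∈ Set.Icc (0 : ℝ) 1, γ t ∈ upperHalfSpace d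
  differentiable : DifferentiableOn ℝ γ (Set.Icc 0 1)
  integrable : IntervalIntegrable
    (fun t => finslerNorm (γ t) (derivWithin γ (Set.Icc 0 1) t)) MeasureTheory.volume 0 1

/-- The Finsler length `∫₀¹ F_{γ(t)}(γ'(t)) dt` of a path. -/
def length (γ : ℝ → Matrix (Fin d) (Fin d) ℂ) : ℝ :=
  ∫ t in (0 : ℝ)..1, finslerNorm (γ t) (derivWithin γ (Set.Icc 0 1) t)

/-- The metric `d_∞(Z₁, Z₂)`: the infimum of the lengths of all differentiable paths in the Siegel
upper half space that join `Z₁` to `Z₂`. -/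
def dInf (Z₁ Z₂ : Matrix (Fin d) (Fin d) ℂ) : ℝ :=
  sInf {L : ℝ | ∃ γ : ℝ → Matrix (Fin d) (Fin d) ℂ, IsPath Z₁ Z₂ γ ∧ L = length γ}

theorem imPart_posDef {Z : Matrix (Fin d) (Fin d) ℂ} (hZ : Z ∈ upperHalfSpace d) :
    (imPart Z).PosDef := by
  obtain ⟨-, -, h⟩ := hZ
  obtain ⟨A, hA, hu⟩ : ∃ A : Matrix (Fin d) (Fin d) ℝ, Z.map Complex.im = Aᴴ * A ∧ IsUnit A := by
    have h0 := h.posSemidef.nonneg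
    refine ⟨CFC.sqrt (Z.map Complex.im), ?_, ?_⟩
    · have : (CFC.sqrt (Z.map Complex.im))ᴴ = CFC.sqrt (Z.map Complex.im) :=
        (CFC.sqrt_nonneg (Z.map Complex.im)).posSemidef.isHermitian
      rw [this, CFC.sqrt_mul_sqrt_self _ h0]
    · rw [CFC.isUnit_sqrt_iff _ h0]
      exact h.isUnit
  have hm : imPart Z = (A.map Complex.ofReal)ᴴ * A.map Complex.ofReal := by
    rw [imPart, hA]
    ext i j
    simp [Matrix.mul_apply]
  rw [hm]
  have hu' : IsUnit (A.map Complex.ofReal) := hu.map (Complex.ofRealHom.mapMatrix (m := Fin d))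
  exact Matrix.PosDef.conjTranspose_mul_self _ (Matrix.mulVec_injective_of_isUnit hu')

theorem isUnit_sqrt_imPart {Z : Matrix (Fin d) (Fin d) ℂ} (hZ : Z ∈ upperHalfSpace d) :
    IsUnit (CFC.sqrt (imPart Z)) := by
  rw [CFC.isUnit_sqrt_iff _ (imPart_posDef hZ).posSemidef.nonneg]
  exact (imPart_posDef hZ).isUnit

theorem continuous_imPart : Continuous (imPart (d := d)) := by
  refine continuous_matrix fun i j => ?_
  simp only [imPart, Matrix.map_apply]
  exact Complex.continuous_ofReal.comp (Complex.continuous_im.comp (continuous_apply_apply i j))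

theorem continuousOn_invSqrtIm : ContinuousOn (invSqrtIm (d := d)) (upperHalfSpace d) := by
  intro Z hZ
  have h1 : ContinuousOn (fun Z : Matrix (Fin d) (Fin d) ℂ => CFC.sqrt (imPart Z))
      (upperHalfSpace d) :=
    CFC.continuousOn_sqrt.comp continuous_imPart.continuousOn
      fun Z hZ => (imPart_posDef hZ).posSemidef.nonneg
  obtain ⟨u, hu⟩ := isUnit_sqrt_imPart hZ
  have h2 := NormedRing.inverse_continuousAt u
  rw [hu] at h2
  have h3 := ContinuousAt.comp_continuousWithinAt
    (f := fun Z : Matrix (Fin d) (Fin d) ℂ => CFC.sqrt (imPart Z)) h2 (h1 Z hZ)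
  refine h3.congr (fun _ _ => ?_) ?_ <;> simp [invSqrtIm, Matrix.nonsing_inv_eq_ringInverse]

theorem add_smul_mem {Z₁ Z₂ : Matrix (Fin d) (Fin d) ℂ} (h₁ : Z₁ ∈ upperHalfSpace d)
    (h₂ : Z₂ ∈ upperHalfSpace d) {t : ℝ} (ht : t ∈ Set.Icc (0 : ℝ) 1) :
    Z₁ + t • (Z₂ - Z₁) ∈ upperHalfSpace d := by
  have e : ∀ i j, ((Z₁ + t • (Z₂ - Z₁)) i j).im = (1 - t) * (Z₁ i j).im + t * (Z₂ i j).im := by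
    intro i j; simp; ring
  have e' : ∀ i j, ((Z₁ + t • (Z₂ - Z₁)) i j).re = (1 - t) * (Z₁ i j).re + t * (Z₂ i j).re := by
    intro i j; simp; ring
  obtain ⟨a₁, b₁, c₁⟩ := h₁
  obtain ⟨a₂, b₂, c₂⟩ := h₂
  refine ⟨?_, ?_, ?_⟩
  · ext i j
    have := congrFun₂ a₁ i j
    have := congrFun₂ a₂ i j
    simp only [transpose_apply, map_apply] at *
    rw [e', e']; simp_all
  · ext i j
    have := congrFun₂ b₁ i j
    have := congrFun₂ b₂ i j
    simp only [transpose_apply, map_apply] at *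
    rw [e, e]; simp_all
  · have : (Z₁ + t • (Z₂ - Z₁)).map Complex.im
        = (1 - t) • Z₁.map Complex.im + t • Z₂.map Complex.im := by
      ext i j
      rw [map_apply, e]; simp
    rw [this]
    rcases eq_or_lt_of_le ht.1 with h | h
    · subst h; simpa using c₁
    · exact Matrix.PosDef.posSemidef_add (c₁.posSemidef.smul (by linarith [ht.2])) (c₂.smul h)

/-- Any two points of the Siegel upper half space are joined by a path of finite length, so that
`dInf` is the infimum of a nonempty set of nonnegative numbers. -/
theorem exists_isPath {Z₁ Z₂ : Matrix (Fin d) (Fin d) ℂ} (h₁ : Z₁ ∈ upperHalfSpace d)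
    (h₂ : Z₂ ∈ upperHalfSpace d) : ∃ γ, IsPath Z₁ Z₂ γ := by
  have hd : ∀ t : ℝ, HasDerivAt (fun t : ℝ => Z₁ + t • (Z₂ - Z₁)) (Z₂ - Z₁) t := fun t => by
    simpa using ((hasDerivAt_id t).smul_const (Z₂ - Z₁)).const_add Z₁
  refine ⟨fun t => Z₁ + t • (Z₂ - Z₁), by simp, by simp, fun t ht => add_smul_mem h₁ h₂ ht,
    fun t _ => (hd t).differentiableAt.differentiableWithinAt, ?_⟩
  apply ContinuousOn.intervalIntegrable
  rw [Set.uIcc_of_le zero_le_one]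
  have hc : ContinuousOn (fun t : ℝ => invSqrtIm (Z₁ + t • (Z₂ - Z₁))) (Set.Icc 0 1) :=
    continuousOn_invSqrtIm.comp (fun t _ => (hd t).continuousAt.continuousWithinAt)
      fun t ht => add_smul_mem h₁ h₂ ht
  have hn : ContinuousOn (fun t : ℝ => ‖invSqrtIm (Z₁ + t • (Z₂ - Z₁)) * (Z₂ - Z₁) *
      invSqrtIm (Z₁ + t • (Z₂ - Z₁))‖) (Set.Icc 0 1) :=
    ((hc.mul continuousOn_const).mul hc).norm
  refine hn.congr fun t ht => ?_
  simp only [finslerNorm]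
  rw [(hd t).hasDerivWithinAt.derivWithin (uniqueDiffOn_Icc zero_lt_one t ht)]

/-- The denominator `C Z + D` of the matrix fractional linear map of `T = (A B; C D)`. -/
def fltDenom (T : Matrix (Fin d ⊕ Fin d) (Fin d ⊕ Fin d) ℂ) (Z : Matrix (Fin d) (Fin d) ℂ) :
    Matrix (Fin d) (Fin d) ℂ :=
  T.toBlocks₂₁ * Z + T.toBlocks₂₂

/-- The matrix fractional linear map `T(Z) = (A Z + B) (C Z + D)⁻¹` of `T = (A B; C D)`, meaningful
where `C Z + D` is invertible. -/
def flt (T : Matrix (Fin d ⊕ Fin d) (Fin d ⊕ Fin d) ℂ) (Z : Matrix (Fin d) (Fin d) ℂ) :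
    Matrix (Fin d) (Fin d) ℂ :=
  (T.toBlocks₁₁ * Z + T.toBlocks₁₂) * (fltDenom T Z)⁻¹

/-- The transfer matrix `T_-(n, z) = (zI - B(n), -I; I, 0)` of the discrete Schrödinger equation
`y(n+1) + y(n-1) + B(n) y(n) = z y(n)`. -/
def transferMinus (B : ℕ → Matrix (Fin d) (Fin d) ℝ) (n : ℕ) (z : ℂ) :
    Matrix (Fin d ⊕ Fin d) (Fin d ⊕ Fin d) ℂ :=
  Matrix.fromBlocks (z • (1 : Matrix (Fin d) (Fin d) ℂ) - (B n).map Complex.ofReal) (-1) 1 0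

end Siegel

end

open Matrix
open scoped Matrix.Norms.L2Operator MatrixOrder ComplexOrder

noncomputable section

namespace Siegel

variable {d : ℕ}

/-! The transfer map is `W ↦ z - B - W⁻¹`, with derivative `V ↦ W⁻¹ V W⁻¹`. Everything is expressed
through the quadratic form `imForm`: the Finsler norm of `V` at `W` is the best constant in `|a* V
b| ≤ r √(imForm W a) √(imForm W b)`. If `Im W ≥ y` and `q = imForm W (W⁻¹ a)`, Cauchy-Schwarz gives
`y q ≤ |a|²`, so the imaginary part of the image, `y |a|² + q` at `a`, is at least `(1 + y²) q`.
Hence the derivative contracts by `1 / (1 + y²)` on the region `Im W ≥ y`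
(`finslerNorm_sub_inv_le`), a region that contains every image of a transfer map
(`le_imForm_sub_inv`).

A nearly shortest path from `W₁` to `W₂` might leave this region, so an explicit minimizer is used.
The Cayley transform centred at `W₁` sends `W₁` to `0` and `W₂` to some `E` with `‖E‖ < 1`. Every
path has length at least `log ((1 + ‖E‖) / (1 - ‖E‖))` (`log_norm_cayley_le_length`). The preimage
of the segment `t • E` has length at most this value (`finslerNorm_invCayley_le`,
`integral_speed_le`) and stays in the region (`le_imForm_invCayley`). Its image under the transfer
map therefore witnesses the contraction. -/

/-! ### Euclidean norms and sesquilinear pairings. -/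

/-- The Euclidean norm of a vector in `ℂ^d`. -/
def vecNorm (a : Fin d → ℂ) : ℝ := ‖WithLp.toLp 2 a‖

/-- The imaginary part of the sesquilinear form of `Z`. -/
def imForm (Z : Matrix (Fin d) (Fin d) ℂ) (a : Fin d → ℂ) : ℝ := (star a ⬝ᵥ Z *ᵥ a).im

theorem vecNorm_nonneg (a : Fin d → ℂ) : 0 ≤ vecNorm a := norm_nonneg _

theorem vecNorm_zero : vecNorm (0 : Fin d → ℂ) = 0 := by simp [vecNorm]

theorem vecNorm_pos {a : Fin d → ℂ} (ha : a ≠ 0) : 0 < vecNorm a := by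
  simpa [vecNorm] using ha

theorem star_dotProduct_self (a : Fin d → ℂ) : star a ⬝ᵥ a = ((vecNorm a ^ 2 : ℝ) : ℂ) := by
  have h := inner_self_eq_norm_sq_to_K (𝕜 := ℂ) (WithLp.toLp 2 a)
  rw [EuclideanSpace.inner_eq_star_dotProduct] at h
  rw [dotProduct_comm]
  simpa [vecNorm] using h

theorem vecNorm_sq (a : Fin d → ℂ) : vecNorm a ^ 2 = (star a ⬝ᵥ a).re := by
  rw [star_dotProduct_self, Complex.ofReal_re]

theorem norm_star_dotProduct_le (a b : Fin d → ℂ) :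
    ‖star a ⬝ᵥ b‖ ≤ vecNorm a * vecNorm b := by
  have h := norm_inner_le_norm (𝕜 := ℂ) (WithLp.toLp 2 a) (WithLp.toLp 2 b)
  rw [EuclideanSpace.inner_eq_star_dotProduct] at h
  rw [dotProduct_comm]
  exact h

theorem vecNorm_mulVec_le (M : Matrix (Fin d) (Fin d) ℂ) (a : Fin d → ℂ) :
    vecNorm (M *ᵥ a) ≤ ‖M‖ * vecNorm a :=
  Matrix.l2_opNorm_mulVec M (WithLp.toLp 2 a)

theorem star_mulVec_dotProduct (M : Matrix (Fin d) (Fin d) ℂ) (a b : Fin d → ℂ) :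
    star (M *ᵥ a) ⬝ᵥ b = star a ⬝ᵥ Mᴴ *ᵥ b := by
  rw [star_mulVec, dotProduct_mulVec]

theorem star_star_dotProduct (a b : Fin d → ℂ) : star (star a ⬝ᵥ b) = star b ⬝ᵥ a := by
  rw [star_dotProduct, star_star]

theorem im_star_dotProduct_comm (a b : Fin d → ℂ) : (star a ⬝ᵥ b).im = -(star b ⬝ᵥ a).im := by
  rw [← star_star_dotProduct]; simp

theorem re_star_dotProduct_comm (a b : Fin d → ℂ) : (star a ⬝ᵥ b).re = (star b ⬝ᵥ a).re := by
  rw [← star_star_dotProduct]; simp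

/-- Testing with `a = M x` gives `|M x|² ≤ r |M x| |x|`. -/
theorem opNorm_le_of_form {M : Matrix (Fin d) (Fin d) ℂ} {r : ℝ} (hr : 0 ≤ r)
    (h : ∀ a b, ‖star a ⬝ᵥ M *ᵥ b‖ ≤ r * vecNorm a * vecNorm b) : ‖M‖ ≤ r := by
  rw [Matrix.l2_opNorm_def]
  refine ContinuousLinearMap.opNorm_le_bound _ hr fun x => ?_
  change vecNorm (M *ᵥ x.ofLp) ≤ r * vecNorm x.ofLp
  have h1 := h (M *ᵥ x.ofLp) x.ofLp
  rw [star_dotProduct_self, Complex.norm_real, Real.norm_of_nonneg (sq_nonneg _)] at h1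
  rcases (vecNorm_nonneg (M *ᵥ x.ofLp)).eq_or_lt with h0 | h0
  · rw [← h0]; exact mul_nonneg hr (vecNorm_nonneg _)
  · nlinarith

theorem vecNorm_sub_sq (a b : Fin d → ℂ) :
    vecNorm (a - b) ^ 2 = vecNorm a ^ 2 - 2 * (star a ⬝ᵥ b).re + vecNorm b ^ 2 := by
  have := re_star_dotProduct_comm a b
  simp only [vecNorm_sq, star_sub, sub_dotProduct, dotProduct_sub, Complex.sub_re]
  linarith

theorem vecNorm_smul (c : ℂ) (a : Fin d → ℂ) : vecNorm (c • a) = ‖c‖ * vecNorm a := by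
  simp [vecNorm, WithLp.toLp_smul, norm_smul]

/-! ### Imaginary parts as quadratic forms; the Finsler norm in terms of them. -/

theorem imForm_conjTranspose (Z : Matrix (Fin d) (Fin d) ℂ) (a : Fin d → ℂ) :
    imForm Zᴴ a = -imForm Z a := by
  rw [imForm, ← star_mulVec_dotProduct, im_star_dotProduct_comm, imForm]

/-- For symmetric `Z` the conjugate transpose is the entrywise conjugate. This links the entrywise
imaginary part to the form `imForm`. -/
theorem imPart_eq {Z : Matrix (Fin d) (Fin d) ℂ} (hZ : Zᵀ = Z) :
    (2 * Complex.I) • imPart Z = Z - Zᴴ := by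
  ext i j
  have h : Z j i = Z i j := congrFun₂ hZ i j
  simp only [imPart, Matrix.smul_apply, map_apply, Matrix.sub_apply, conjTranspose_apply, h, smul_eq_mul]
  apply Complex.ext <;> simp
  ring

theorem dotProduct_imPart {Z : Matrix (Fin d) (Fin d) ℂ} (hZ : Zᵀ = Z) (a : Fin d → ℂ) :
    star a ⬝ᵥ imPart Z *ᵥ a = (imForm Z a : ℂ) := by
  have h : (2 * Complex.I) * (star a ⬝ᵥ imPart Z *ᵥ a) =
      star a ⬝ᵥ Z *ᵥ a - star a ⬝ᵥ Zᴴ *ᵥ a := by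
    rw [← dotProduct_sub, ← sub_mulVec, ← imPart_eq hZ, smul_mulVec, dotProduct_smul, smul_eq_mul]
  have h2 : star a ⬝ᵥ Zᴴ *ᵥ a = star (star a ⬝ᵥ Z *ᵥ a) := by
    rw [star_star_dotProduct, star_mulVec_dotProduct]
  rw [h2] at h
  have h3 : (2 * Complex.I) * (star a ⬝ᵥ imPart Z *ᵥ a) = (2 * Complex.I) * (imForm Z a : ℂ) := by
    rw [h, imForm]
    apply Complex.ext <;> simp; ring
  exact mul_left_cancel₀ (by simp) h3

theorem transpose_eq_of_mem {Z : Matrix (Fin d) (Fin d) ℂ} (hZ : Z ∈ upperHalfSpace d) :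
    Zᵀ = Z := by
  ext i j
  exact Complex.ext (congrFun₂ hZ.1 i j) (congrFun₂ hZ.2.1 i j)

theorem imForm_pos {Z : Matrix (Fin d) (Fin d) ℂ} (hZ : Z ∈ upperHalfSpace d) {a : Fin d → ℂ}
    (ha : a ≠ 0) : 0 < imForm Z a := by
  have h := (imPart_posDef hZ).dotProduct_mulVec_pos ha
  rw [dotProduct_imPart (transpose_eq_of_mem hZ)] at h
  exact_mod_cast h

theorem imForm_nonneg {Z : Matrix (Fin d) (Fin d) ℂ} (hZ : Z ∈ upperHalfSpace d)
    (a : Fin d → ℂ) : 0 ≤ imForm Z a := by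
  by_cases ha : a = 0
  · simp [ha, imForm]
  · exact (imForm_pos hZ ha).le

theorem mem_upperHalfSpace {Z : Matrix (Fin d) (Fin d) ℂ} (hZ : Zᵀ = Z)
    (h : ∀ a : Fin d → ℂ, a ≠ 0 → 0 < imForm Z a) : Z ∈ upperHalfSpace d := by
  have e : ∀ i j, Z j i = Z i j := fun i j => congrFun₂ hZ i j
  have him : (Z.map Complex.im)ᵀ = Z.map Complex.im := by ext i j; simp [e]
  refine ⟨by ext i j; simp [e], him, ?_⟩
  refine Matrix.PosDef.of_dotProduct_mulVec_pos ?_ fun x hx => ?_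
  · ext i j; simp [e]
  · have hx' : (fun i => (x i : ℂ)) ≠ 0 := by
      intro h0
      apply hx
      ext i
      simpa using congrFun h0 i
    have h1 := h _ hx'
    have h2 : imForm Z (fun i => (x i : ℂ)) = star x ⬝ᵥ Z.map Complex.im *ᵥ x := by
      simp [imForm, dotProduct, mulVec, Complex.mul_im]
    rwa [h2] at h1

theorem sqrt_imPart_sq {Z : Matrix (Fin d) (Fin d) ℂ} (hZ : Z ∈ upperHalfSpace d) :
    CFC.sqrt (imPart Z) * CFC.sqrt (imPart Z) = imPart Z :=
  CFC.sqrt_mul_sqrt_self _ (imPart_posDef hZ).posSemidef.nonneg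

theorem conjTranspose_sqrt (M : Matrix (Fin d) (Fin d) ℂ) : (CFC.sqrt M)ᴴ = CFC.sqrt M :=
  (CFC.sqrt_nonneg M).posSemidef.isHermitian

theorem vecNorm_sqrt_mulVec {Z : Matrix (Fin d) (Fin d) ℂ} (hZ : Z ∈ upperHalfSpace d)
    (a : Fin d → ℂ) : vecNorm (CFC.sqrt (imPart Z) *ᵥ a) = √(imForm Z a) := by
  rw [eq_comm, Real.sqrt_eq_iff_mul_self_eq (imForm_nonneg hZ a) (vecNorm_nonneg _), ← sq,
    vecNorm_sq, star_mulVec_dotProduct, conjTranspose_sqrt, mulVec_mulVec, sqrt_imPart_sq hZ,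
    dotProduct_imPart (transpose_eq_of_mem hZ), Complex.ofReal_re]

/-- Substitute `S a`, `S b` with `S` the root of the imaginary part: `|S a|² = imForm Z a`. Together
with `finslerNorm_le` this characterizes the Finsler norm without matrix square roots. -/
theorem norm_form_le_finslerNorm {Z : Matrix (Fin d) (Fin d) ℂ} (hZ : Z ∈ upperHalfSpace d)
    (W : Matrix (Fin d) (Fin d) ℂ) (a b : Fin d → ℂ) :
    ‖star a ⬝ᵥ W *ᵥ b‖ ≤ finslerNorm Z W * √(imForm Z a) * √(imForm Z b) := by
  have hu := (Matrix.isUnit_iff_isUnit_det _).mp (isUnit_sqrt_imPart hZ)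
  have hS := conjTranspose_sqrt (imPart Z)
  rw [← vecNorm_sqrt_mulVec hZ, ← vecNorm_sqrt_mulVec hZ, finslerNorm, invSqrtIm]
  generalize CFC.sqrt (imPart Z) = S at *
  have hW : W = S * (S⁻¹ * W * S⁻¹ * S) := by
    rw [Matrix.mul_assoc _ S⁻¹ S, nonsing_inv_mul _ hu, Matrix.mul_one,
      mul_nonsing_inv_cancel_left _ _ hu]
  have e : star a ⬝ᵥ W *ᵥ b = star (S *ᵥ a) ⬝ᵥ (S⁻¹ * W * S⁻¹) *ᵥ (S *ᵥ b) := by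
    rw [star_mulVec_dotProduct, hS, mulVec_mulVec, mulVec_mulVec, Matrix.mul_assoc S, ← hW]
  rw [e, mul_comm ‖S⁻¹ * W * S⁻¹‖, mul_assoc (vecNorm _)]
  exact (norm_star_dotProduct_le _ _).trans
    (mul_le_mul_of_nonneg_left (vecNorm_mulVec_le _ _) (vecNorm_nonneg _))

theorem finslerNorm_le {Z : Matrix (Fin d) (Fin d) ℂ} (hZ : Z ∈ upperHalfSpace d)
    {W : Matrix (Fin d) (Fin d) ℂ} {r : ℝ} (hr : 0 ≤ r)
    (h : ∀ a b, ‖star a ⬝ᵥ W *ᵥ b‖ ≤ r * √(imForm Z a) * √(imForm Z b)) :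
    finslerNorm Z W ≤ r := by
  have hu := (Matrix.isUnit_iff_isUnit_det _).mp (isUnit_sqrt_imPart hZ)
  have hS := conjTranspose_sqrt (imPart Z)
  simp only [← vecNorm_sqrt_mulVec hZ] at h
  rw [finslerNorm, invSqrtIm]
  generalize CFC.sqrt (imPart Z) = S at *
  refine opNorm_le_of_form hr fun a b => ?_
  have h1 := h (S⁻¹ *ᵥ a) (S⁻¹ *ᵥ b)
  have hv : ∀ a, S *ᵥ S⁻¹ *ᵥ a = a := fun a => by
    rw [mulVec_mulVec, mul_nonsing_inv _ hu, one_mulVec]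
  rwa [hv, hv, star_mulVec_dotProduct, conjTranspose_nonsing_inv, hS, mulVec_mulVec,
    mulVec_mulVec, Matrix.mul_assoc, ← Matrix.mul_assoc] at h1

theorem finslerNorm_nonneg (Z W : Matrix (Fin d) (Fin d) ℂ) : 0 ≤ finslerNorm Z W := norm_nonneg _

/-! ### Inverses and the infinitesimal contraction. -/

theorem isUnit_of_imForm_pos {D : Matrix (Fin d) (Fin d) ℂ}
    (h : ∀ a : Fin d → ℂ, a ≠ 0 → 0 < imForm D a) : IsUnit D := by
  rw [← Matrix.mulVec_injective_iff_isUnit]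
  intro a b hab
  by_contra hne
  have := h (a - b) (sub_ne_zero.mpr hne)
  rw [imForm, mulVec_sub, hab, sub_self, dotProduct_zero] at this
  exact lt_irrefl _ this

theorem isUnit_of_mem {Z : Matrix (Fin d) (Fin d) ℂ} (hZ : Z ∈ upperHalfSpace d) : IsUnit Z :=
  isUnit_of_imForm_pos fun _ ha => imForm_pos hZ ha

theorem imForm_sub (Z W : Matrix (Fin d) (Fin d) ℂ) (a : Fin d → ℂ) :
    imForm (Z - W) a = imForm Z a - imForm W a := by
  simp [imForm, sub_mulVec, dotProduct_sub]

/-- With `u = Z⁻¹ a`, the number `a* Z⁻¹ a = (Z u)* u` is the conjugate of `u* Z u`. -/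
theorem imForm_inv {Z : Matrix (Fin d) (Fin d) ℂ} (hZ : IsUnit Z) (a : Fin d → ℂ) :
    imForm Z⁻¹ a = -imForm Z (Z⁻¹ *ᵥ a) := by
  have hu := (Matrix.isUnit_iff_isUnit_det _).mp hZ
  rw [imForm, im_star_dotProduct_comm, imForm, mulVec_mulVec, mul_nonsing_inv _ hu, one_mulVec]

/-- In a pairing `a* Z⁻¹ V Z⁻¹ b` the left vector becomes `(Z⁻¹)ᴴ a`, so both versions are needed.
-/
theorem imForm_inv_conjTranspose {Z : Matrix (Fin d) (Fin d) ℂ} (hZ : IsUnit Z) (a : Fin d → ℂ) :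
    imForm Z⁻¹ a = -imForm Z ((Z⁻¹)ᴴ *ᵥ a) := by
  have h : IsUnit Zᴴ := hZ.star
  have h1 := imForm_inv h a
  rw [← conjTranspose_nonsing_inv, imForm_conjTranspose, imForm_conjTranspose] at h1
  linarith

theorem imForm_flt {z : ℂ} {B Z : Matrix (Fin d) (Fin d) ℂ} (hB : Bᴴ = B) (a : Fin d → ℂ) :
    imForm (z • (1 : Matrix (Fin d) (Fin d) ℂ) - B - Z⁻¹) a =
      z.im * vecNorm a ^ 2 - imForm Z⁻¹ a := by
  have h : imForm B a = 0 := by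
    have := imForm_conjTranspose B a
    rw [hB] at this; linarith
  rw [imForm_sub, imForm_sub, h, imForm, smul_mulVec, one_mulVec, dotProduct_smul,
    star_dotProduct_self, smul_eq_mul, Complex.im_mul_ofReal]
  ring

/-- Real parts suffice: for `a` the normalized `M v`, the pairing is real and equals the norm of `M
v` up to scaling. -/
theorem opNorm_le_of_re_le {M : Matrix (Fin d) (Fin d) ℂ} {r : ℝ} (hr : 0 ≤ r)
    (h : ∀ a b, vecNorm a = 1 → vecNorm b = 1 → (star a ⬝ᵥ M *ᵥ b).re ≤ r) : ‖M‖ ≤ r := by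
  rw [Matrix.l2_opNorm_def]
  refine ContinuousLinearMap.opNorm_le_bound _ hr fun x => ?_
  change vecNorm (M *ᵥ x.ofLp) ≤ r * vecNorm x.ofLp
  generalize x.ofLp = v
  have normalize : ∀ w : Fin d → ℂ, 0 < vecNorm w →
      vecNorm (((vecNorm w)⁻¹ : ℂ) • w) = 1 := fun w hw => by
    rw [vecNorm_smul, norm_inv, Complex.norm_real, Real.norm_of_nonneg hw.le,
      inv_mul_cancel₀ hw.ne']
  rcases (vecNorm_nonneg (M *ᵥ v)).eq_or_lt with h0 | h0
  · rw [← h0]; exact mul_nonneg hr (vecNorm_nonneg _)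
  have hv : 0 < vecNorm v := vecNorm_pos fun hv => by
    rw [hv, mulVec_zero, vecNorm_zero] at h0
    exact lt_irrefl _ h0
  have h1 := h _ _ (normalize _ h0) (normalize _ hv)
  rw [mulVec_smul, dotProduct_smul, star_smul, smul_dotProduct, star_dotProduct_self,
    star_inv₀, Complex.star_def, Complex.conj_ofReal, smul_eq_mul, smul_eq_mul] at h1
  norm_cast at h1
  have h2 : (vecNorm v)⁻¹ * ((vecNorm (M *ᵥ v))⁻¹ * vecNorm (M *ᵥ v) ^ 2) =
      vecNorm (M *ᵥ v) / vecNorm v := by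
    field_simp
  rw [h2, div_le_iff₀ hv] at h1
  exact h1

/-- Chain `y q² ≤ y |u|² |w|² ≤ q |w|²` and cancel `q`. This is the source of the `y²` in the
contraction constant. -/
theorem mul_le_vecNorm_sq {q y : ℝ} {u w : Fin d → ℂ} (hq : 0 ≤ q) (hy : y * vecNorm u ^ 2 ≤ q)
    (h : q ≤ vecNorm u * vecNorm w) : y * q ≤ vecNorm w ^ 2 := by
  rcases le_or_gt y 0 with h0 | h0
  · exact (mul_nonpos_of_nonpos_of_nonneg h0 hq).trans (sq_nonneg _)
  rcases hq.eq_or_lt with hq0 | hq0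
  · rw [← hq0, mul_zero]; positivity
  have h1 : q ^ 2 ≤ vecNorm u ^ 2 * vecNorm w ^ 2 := by
    rw [← mul_pow]; exact pow_le_pow_left₀ hq h 2
  have h2 : q * (y * q) ≤ q * vecNorm w ^ 2 := by
    nlinarith [mul_le_mul_of_nonneg_left h1 h0.le,
      mul_le_mul_of_nonneg_right hy (sq_nonneg (vecNorm w))]
  exact le_of_mul_le_mul_left h2 hq0

theorem imForm_le (M : Matrix (Fin d) (Fin d) ℂ) (u : Fin d → ℂ) :
    |imForm M u| ≤ vecNorm u * vecNorm (M *ᵥ u) :=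
  (Complex.abs_im_le_norm _).trans (norm_star_dotProduct_le _ _)

/-- On matrices whose imaginary part is at least `y`, the derivative of `W ↦ z - B - W⁻¹`
contracts the Finsler norm by the factor `1 / (1 + y ^ 2)`. -/
theorem finslerNorm_sub_inv_le {z : ℂ} (hz : 0 < z.im) {B W : Matrix (Fin d) (Fin d) ℂ}
    (hB : Bᴴ = B) (hW : W ∈ upperHalfSpace d) (hy : ∀ a, z.im * vecNorm a ^ 2 ≤ imForm W a)
    (hT : z • (1 : Matrix (Fin d) (Fin d) ℂ) - B - W⁻¹ ∈ upperHalfSpace d)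
    (V : Matrix (Fin d) (Fin d) ℂ) :
    finslerNorm (z • (1 : Matrix (Fin d) (Fin d) ℂ) - B - W⁻¹) (W⁻¹ * V * W⁻¹) ≤
      1 / (1 + z.im ^ 2) * finslerNorm W V := by
  set y := z.im
  have hu := (Matrix.isUnit_iff_isUnit_det _).mp (isUnit_of_mem hW)
  have hc : 0 < 1 + y ^ 2 := by positivity
  have key : ∀ a, imForm W (W⁻¹ *ᵥ a) ≤
      imForm (z • (1 : Matrix (Fin d) (Fin d) ℂ) - B - W⁻¹) a / (1 + y ^ 2) := fun a => by
    have h1 := mul_le_vecNorm_sq (imForm_nonneg hW (W⁻¹ *ᵥ a)) (hy _)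
      ((le_abs_self _).trans (imForm_le _ _))
    rw [mulVec_mulVec, mul_nonsing_inv _ hu, one_mulVec] at h1
    rw [le_div_iff₀ hc, imForm_flt hB, imForm_inv (isUnit_of_mem hW)]
    -- Multiplying `y q ≤ |a|²` by `y` gives `(1 + y²) q ≤ y |a|² + q`.
    nlinarith [mul_le_mul_of_nonneg_left h1 hz.le]
  have key' : ∀ a, imForm W ((W⁻¹)ᴴ *ᵥ a) ≤
      imForm (z • (1 : Matrix (Fin d) (Fin d) ℂ) - B - W⁻¹) a / (1 + y ^ 2) := fun a => by
    have h0 := imForm_le Wᴴ ((W⁻¹)ᴴ *ᵥ a)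
    rw [imForm_conjTranspose, abs_neg] at h0
    have h1 := mul_le_vecNorm_sq (imForm_nonneg hW ((W⁻¹)ᴴ *ᵥ a)) (hy _)
      ((le_abs_self _).trans h0)
    rw [mulVec_mulVec, ← conjTranspose_mul, nonsing_inv_mul _ hu, conjTranspose_one,
      one_mulVec] at h1
    rw [le_div_iff₀ hc, imForm_flt hB, imForm_inv_conjTranspose (isUnit_of_mem hW)]
    nlinarith [mul_le_mul_of_nonneg_left h1 hz.le]
  refine finslerNorm_le hT (by have := finslerNorm_nonneg W V; positivity) fun a b => ?_
  have e : star a ⬝ᵥ (W⁻¹ * V * W⁻¹) *ᵥ b = star ((W⁻¹)ᴴ *ᵥ a) ⬝ᵥ V *ᵥ (W⁻¹ *ᵥ b) := by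
    rw [star_mulVec_dotProduct, conjTranspose_conjTranspose, mulVec_mulVec, mulVec_mulVec,
      Matrix.mul_assoc]
  rw [e]
  refine (norm_form_le_finslerNorm hW _ _ _).trans ?_
  have ha := Real.sqrt_le_sqrt (key' a)
  have hb := Real.sqrt_le_sqrt (key b)
  have hF := finslerNorm_nonneg W V
  calc _ ≤ finslerNorm W V *
        √(imForm (z • (1 : Matrix (Fin d) (Fin d) ℂ) - B - W⁻¹) a / (1 + y ^ 2)) *
        √(imForm (z • (1 : Matrix (Fin d) (Fin d) ℂ) - B - W⁻¹) b / (1 + y ^ 2)) := by gcongr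
    _ = _ := by
      rw [Real.sqrt_div' _ hc.le, Real.sqrt_div' _ hc.le]
      have := Real.mul_self_sqrt hc.le
      field_simp
      rw [Real.sq_sqrt hc.le]

/-! ### The Cayley transform centred at a point. -/

theorem transpose_sqrt {M : Matrix (Fin d) (Fin d) ℂ} (hM : M.PosSemidef) (h : Mᵀ = M) :
    (CFC.sqrt M)ᵀ = CFC.sqrt M := by
  refine (CFC.sqrt_unique ?_ (CFC.sqrt_nonneg M).posSemidef.transpose.nonneg).symm
  rw [← transpose_mul, CFC.sqrt_mul_sqrt_self _ hM.nonneg, h]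

/-- The Cayley transform sending the Siegel upper half space to the unit ball and `Z₁` to `0`,
where `R` is the square root of the imaginary part of `Z₁`. -/
def cayley (R Z₁ Z : Matrix (Fin d) (Fin d) ℂ) : Matrix (Fin d) (Fin d) ℂ :=
  1 - (2 * Complex.I) • (R * (Z - Z₁ᴴ)⁻¹ * R)

theorem vecNorm_sub_two_I_smul_sq (v w : Fin d → ℂ) :
    vecNorm (v - (2 * Complex.I) • w) ^ 2 =
      vecNorm v ^ 2 + 4 * (star v ⬝ᵥ w).im + 4 * vecNorm w ^ 2 := by
  rw [vecNorm_sub_sq, dotProduct_smul, vecNorm_smul, mul_pow]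
  simp
  ring

theorem vecNorm_add_two_I_smul_sq (v w : Fin d → ℂ) :
    vecNorm (v + (2 * Complex.I) • w) ^ 2 =
      vecNorm v ^ 2 - 4 * (star v ⬝ᵥ w).im + 4 * vecNorm w ^ 2 := by
  have h := vecNorm_sub_two_I_smul_sq v (-w)
  rw [smul_neg, sub_neg_eq_add] at h
  rw [h, dotProduct_neg, ← neg_one_smul ℂ w, vecNorm_smul]
  simp
  ring

section Cayley

variable {R Z₁ Z : Matrix (Fin d) (Fin d) ℂ}

/-- Put `D = Z - Z₁ᴴ` and `w = D⁻¹ R v`. The cross term contributes `-4 imForm D w`, where `imForm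
D` is the sum of the forms of `Z` and `Z₁`; the `Z₁` part cancels against `4 |R w|²`. -/
theorem vecNorm_cayley_mulVec (hR : Rᴴ = R) (hR2 : ∀ v, vecNorm (R *ᵥ v) ^ 2 = imForm Z₁ v)
    (hD : IsUnit (Z - Z₁ᴴ)) (v : Fin d → ℂ) :
    vecNorm (cayley R Z₁ Z *ᵥ v) ^ 2 =
      vecNorm v ^ 2 - 4 * imForm Z ((Z - Z₁ᴴ)⁻¹ *ᵥ R *ᵥ v) := by
  have hu := (Matrix.isUnit_iff_isUnit_det _).mp hD
  set D := Z - Z₁ᴴ with hDdef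
  have e : cayley R Z₁ Z *ᵥ v = v - (2 * Complex.I) • (R *ᵥ D⁻¹ *ᵥ R *ᵥ v) := by
    rw [cayley, sub_mulVec, one_mulVec, smul_mulVec, mulVec_mulVec, mulVec_mulVec]
  have h1 : (star v ⬝ᵥ R *ᵥ D⁻¹ *ᵥ R *ᵥ v).im = -imForm D (D⁻¹ *ᵥ R *ᵥ v) := by
    rw [← imForm_inv hD, imForm, star_mulVec_dotProduct, hR]
  rw [e, vecNorm_sub_two_I_smul_sq, h1, hR2, hDdef, imForm_sub, imForm_conjTranspose, ← hDdef]
  ring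

theorem vecNorm_cayley_conjTranspose_mulVec (hR : Rᴴ = R)
    (hR2 : ∀ v, vecNorm (R *ᵥ v) ^ 2 = imForm Z₁ v)
    (hD : IsUnit (Z - Z₁ᴴ)) (v : Fin d → ℂ) :
    vecNorm ((cayley R Z₁ Z)ᴴ *ᵥ v) ^ 2 =
      vecNorm v ^ 2 - 4 * imForm Z (((Z - Z₁ᴴ)⁻¹)ᴴ *ᵥ R *ᵥ v) := by
  set D := Z - Z₁ᴴ with hDdef
  have e : (cayley R Z₁ Z)ᴴ *ᵥ v = v + (2 * Complex.I) • (R *ᵥ (D⁻¹)ᴴ *ᵥ R *ᵥ v) := by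
    rw [cayley, conjTranspose_sub, conjTranspose_one, conjTranspose_smul, conjTranspose_mul,
      conjTranspose_mul, hR, sub_mulVec, one_mulVec, smul_mulVec, mulVec_mulVec, mulVec_mulVec,
      ← hDdef, Matrix.mul_assoc]
    simp [sub_eq_add_neg]
  have h1 : (star v ⬝ᵥ R *ᵥ (D⁻¹)ᴴ *ᵥ R *ᵥ v).im = imForm D ((D⁻¹)ᴴ *ᵥ R *ᵥ v) := by
    have h2 := imForm_inv_conjTranspose hD (R *ᵥ v)
    have h3 := imForm_conjTranspose D⁻¹ (R *ᵥ v)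
    rw [h2, neg_neg] at h3
    rw [← h3, imForm, star_mulVec_dotProduct, hR]
  rw [e, vecNorm_add_two_I_smul_sq, h1, hR2, hDdef, imForm_sub, imForm_conjTranspose, ← hDdef]
  ring

theorem isUnit_sub_conjTranspose (hZ₁ : Z₁ ∈ upperHalfSpace d) (hZ : Z ∈ upperHalfSpace d) :
    IsUnit (Z - Z₁ᴴ) := by
  refine isUnit_of_imForm_pos fun a ha => ?_
  rw [imForm_sub, imForm_conjTranspose]
  linarith [imForm_pos hZ ha, imForm_pos hZ₁ ha]

end Cayley

/-! ### Lower bound for the length of an arbitrary path. -/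

theorem hasDerivWithinAt_inv {γ : ℝ → Matrix (Fin d) (Fin d) ℂ} {γ' : Matrix (Fin d) (Fin d) ℂ}
    {s : Set ℝ} {t : ℝ} (h : HasDerivWithinAt γ γ' s t) (hu : IsUnit (γ t)) :
    HasDerivWithinAt (fun t => (γ t)⁻¹) (-((γ t)⁻¹ * γ' * (γ t)⁻¹)) s t := by
  obtain ⟨u, hu⟩ := hu
  have h1 := hasFDerivAt_ringInverse (𝕜 := ℝ) u
  rw [hu] at h1
  have h2 := h1.comp_hasDerivWithinAt t h
  have e : (↑u⁻¹ : Matrix (Fin d) (Fin d) ℂ) = (γ t)⁻¹ := by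
    rw [← hu, Matrix.coe_units_inv]
  simp only [e] at h2
  simpa [Function.comp_def, ← Matrix.nonsing_inv_eq_ringInverse] using h2

/-- The real part of the sesquilinear pairing of `a` with `M b`, as a function of `M`. -/
def reForm (a b : Fin d → ℂ) : Matrix (Fin d) (Fin d) ℂ →L[ℝ] ℝ :=
  LinearMap.mkContinuous
    { toFun := fun M => (star a ⬝ᵥ M *ᵥ b).re
      map_add' := fun M N => by simp [add_mulVec, dotProduct_add]
      map_smul' := fun c M => by simp [smul_mulVec, dotProduct_smul] }
    (vecNorm a * vecNorm b) fun M => by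
      refine (Complex.abs_re_le_norm _).trans ((norm_star_dotProduct_le _ _).trans ?_)
      rw [mul_assoc, mul_comm (vecNorm b)]
      exact mul_le_mul_of_nonneg_left (vecNorm_mulVec_le M b) (vecNorm_nonneg a)

theorem reForm_apply (a b : Fin d → ℂ) (M : Matrix (Fin d) (Fin d) ℂ) :
    reForm a b M = (star a ⬝ᵥ M *ᵥ b).re := rfl

section Lower

variable {R Z₁ Z₂ : Matrix (Fin d) (Fin d) ℂ}

theorem hasDerivWithinAt_cayley {γ : ℝ → Matrix (Fin d) (Fin d) ℂ}
    {γ' : Matrix (Fin d) (Fin d) ℂ} {s : Set ℝ} {t : ℝ} (h : HasDerivWithinAt γ γ' s t)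
    (hu : IsUnit (γ t - Z₁ᴴ)) :
    HasDerivWithinAt (fun t => cayley R Z₁ (γ t))
      ((2 * Complex.I) • (R * ((γ t - Z₁ᴴ)⁻¹ * γ' * (γ t - Z₁ᴴ)⁻¹) * R)) s t := by
  have h1 := hasDerivWithinAt_inv (h.sub_const Z₁ᴴ) hu
  have h2 := (((h1.const_mul R).mul_const R).const_smul (2 * Complex.I)).const_sub 1
  simpa [cayley] using h2

theorem cayley_self (hRR : R * R = imPart Z₁) (hZ₁ : Z₁ᵀ = Z₁) (hRu : IsUnit R.det) :
    cayley R Z₁ Z₁ = 0 := by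
  have hI : (2 * Complex.I) ≠ 0 := by simp
  have h : (2 * Complex.I) • (R * (Z₁ - Z₁ᴴ)⁻¹ * R) = 1 := by
    rw [← imPart_eq hZ₁, ← hRR]
    have : ((2 * Complex.I) • (R * R))⁻¹ = (2 * Complex.I)⁻¹ • (R⁻¹ * R⁻¹) := by
      refine inv_eq_right_inv ?_
      rw [smul_mul_smul_comm, mul_inv_cancel₀ hI, one_smul, Matrix.mul_assoc,
        mul_nonsing_inv_cancel_left _ _ hRu, mul_nonsing_inv _ hRu]
    rw [this, mul_smul_comm, smul_mul_assoc, smul_smul, mul_inv_cancel₀ hI, one_smul,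
      mul_nonsing_inv_cancel_left _ _ hRu, nonsing_inv_mul _ hRu]
  rw [cayley, h, sub_self]

theorem mulVec_ne_zero {M : Matrix (Fin d) (Fin d) ℂ} (hM : IsUnit M) {v : Fin d → ℂ}
    (hv : v ≠ 0) : M *ᵥ v ≠ 0 := fun h =>
  hv (mulVec_injective_of_isUnit hM (by simpa using h))

/-- The hyperbolic length in the unit ball bounds the Finsler length of a path from below. -/
theorem log_reForm_cayley_le_length (hR : Rᴴ = R)
    (hR2 : ∀ v, vecNorm (R *ᵥ v) ^ 2 = imForm Z₁ v) (hRR : R * R = imPart Z₁)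
    (hRu : IsUnit R.det) (hZ₁ : Z₁ ∈ upperHalfSpace d)
    {γ : ℝ → Matrix (Fin d) (Fin d) ℂ} (hγ : IsPath Z₁ Z₂ γ) {a b : Fin d → ℂ}
    (ha : vecNorm a = 1) (hb : vecNorm b = 1) :
    |reForm a b (cayley R Z₁ Z₂)| < 1 ∧
    Real.log (1 + reForm a b (cayley R Z₁ Z₂)) - Real.log (1 - reForm a b (cayley R Z₁ Z₂)) ≤
      length γ := by
  have hb0 : b ≠ 0 := fun h => by simp [h, vecNorm_zero] at hb
  have hD : ∀ t ∈ Set.Icc (0 : ℝ) 1, IsUnit (γ t - Z₁ᴴ) := fun t ht =>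
    isUnit_sub_conjTranspose hZ₁ (hγ.mem t ht)
  -- One real matrix coefficient of the Cayley image reduces the bound to the scalar unit interval.
  set φ : ℝ → ℝ := fun t => reForm a b (cayley R Z₁ (γ t)) with hφ
  have abs_le_right : ∀ t, |φ t| ≤ vecNorm (cayley R Z₁ (γ t) *ᵥ b) := fun t => by
    have h := (Complex.abs_re_le_norm _).trans
      (norm_star_dotProduct_le a (cayley R Z₁ (γ t) *ᵥ b))
    rwa [ha, one_mul] at h
  have abs_le_left : ∀ t, |φ t| ≤ vecNorm ((cayley R Z₁ (γ t))ᴴ *ᵥ a) := fun t => by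
    have h := (Complex.abs_re_le_norm _).trans
      (norm_star_dotProduct_le ((cayley R Z₁ (γ t))ᴴ *ᵥ a) b)
    rwa [hb, mul_one, star_mulVec_dotProduct, conjTranspose_conjTranspose] at h
  have hlt : ∀ t ∈ Set.Icc (0 : ℝ) 1, |φ t| < 1 := fun t ht => by
    have h := vecNorm_cayley_mulVec hR hR2 (hD t ht) b
    have hinv : IsUnit (γ t - Z₁ᴴ)⁻¹ := isUnit_nonsing_inv_iff.mpr (hD t ht)
    have hpos := imForm_pos (hγ.mem t ht)
      (mulVec_ne_zero hinv (mulVec_ne_zero ((Matrix.isUnit_iff_isUnit_det _).mpr hRu) hb0))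
    rw [hb] at h
    nlinarith [abs_le_right t, abs_nonneg (φ t)]
  set γ' := derivWithin γ (Set.Icc 0 1)
  set E' : ℝ → Matrix (Fin d) (Fin d) ℂ := fun t =>
    (2 * Complex.I) • (R * ((γ t - Z₁ᴴ)⁻¹ * γ' t * (γ t - Z₁ᴴ)⁻¹) * R) with hE'
  have hderiv : ∀ t ∈ Set.Icc (0 : ℝ) 1, HasDerivWithinAt φ (reForm a b (E' t)) (Set.Icc 0 1) t :=
    fun t ht => (reForm a b).hasFDerivAt.comp_hasDerivWithinAt t
      (hasDerivWithinAt_cayley (hγ.differentiable t ht).hasDerivWithinAt (hD t ht))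
  -- Infinitesimal Schwarz-Pick estimate: the forms at `α` and `β` are each at most `(1 - φ²) / 4`,
  -- because `|φ|` is bounded by both `|C b|` and `|Cᴴ a|` for the Cayley image `C`.
  have hbound : ∀ t ∈ Set.Icc (0 : ℝ) 1,
      2 * reForm a b (E' t) ≤ finslerNorm (γ t) (γ' t) * (1 - φ t ^ 2) := fun t ht => by
    set α := ((γ t - Z₁ᴴ)⁻¹)ᴴ *ᵥ R *ᵥ a
    set β := (γ t - Z₁ᴴ)⁻¹ *ᵥ R *ᵥ b
    have e : star a ⬝ᵥ E' t *ᵥ b = (2 * Complex.I) * (star α ⬝ᵥ γ' t *ᵥ β) := by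
      simp only [hE', α, β, smul_mulVec, dotProduct_smul, smul_eq_mul, star_mulVec_dotProduct,
        conjTranspose_mul, conjTranspose_conjTranspose, hR, mulVec_mulVec, Matrix.mul_assoc]
    have h1 : reForm a b (E' t) ≤ 2 * ‖star α ⬝ᵥ γ' t *ᵥ β‖ := by
      rw [reForm_apply]
      refine (Complex.re_le_norm _).trans (le_of_eq ?_)
      rw [e]; simp
    have h2 := norm_form_le_finslerNorm (hγ.mem t ht) (γ' t) α β
    have hα := vecNorm_cayley_conjTranspose_mulVec hR hR2 (hD t ht) a
    have hβ := vecNorm_cayley_mulVec hR hR2 (hD t ht) b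
    rw [ha] at hα
    rw [hb] at hβ
    have hα' : imForm (γ t) α ≤ (1 - φ t ^ 2) / 4 := by
      have := pow_le_pow_left₀ (abs_nonneg _) (abs_le_left t) 2
      rw [sq_abs] at this
      linarith
    have hβ' : imForm (γ t) β ≤ (1 - φ t ^ 2) / 4 := by
      have := pow_le_pow_left₀ (abs_nonneg _) (abs_le_right t) 2
      rw [sq_abs] at this
      linarith
    have h0 : 0 ≤ (1 - φ t ^ 2) / 4 := (imForm_nonneg (hγ.mem t ht) α).trans hα'
    have h3 : √(imForm (γ t) α) * √(imForm (γ t) β) ≤ (1 - φ t ^ 2) / 4 := by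
      rw [← Real.mul_self_sqrt h0]
      exact mul_le_mul (Real.sqrt_le_sqrt hα') (Real.sqrt_le_sqrt hβ') (Real.sqrt_nonneg _)
        (Real.sqrt_nonneg _)
    have h4 := mul_le_mul_of_nonneg_left h3 (finslerNorm_nonneg (γ t) (γ' t))
    rw [mul_assoc] at h2
    linarith
  -- The derivative of this primitive is `2 φ' / (1 - φ²)`, which `hbound` compares with the Finsler
  -- speed.
  have hg : ∀ t ∈ Set.Icc (0 : ℝ) 1,
      HasDerivWithinAt (fun t => Real.log (1 + φ t) - Real.log (1 - φ t))
        (reForm a b (E' t) / (1 + φ t) - (-reForm a b (E' t)) / (1 - φ t)) (Set.Icc 0 1) t :=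
    fun t ht => by
      have := abs_lt.mp (hlt t ht)
      exact (((hderiv t ht).const_add 1).log (by linarith)).sub
        (((hderiv t ht).const_sub 1).log (by linarith))
  have hint : MeasureTheory.IntegrableOn (fun t => finslerNorm (γ t) (γ' t)) (Set.Icc 0 1) := by
    rw [integrableOn_Icc_iff_integrableOn_Ioc,
      ← intervalIntegrable_iff_integrableOn_Ioc_of_le zero_le_one]
    exact hγ.integrable
  have hfinal := intervalIntegral.sub_le_integral_of_hasDeriv_right_of_le zero_le_one
    (fun t ht => (hg t ht).continuousWithinAt)
    (fun t ht => ((hg t (Set.Ioo_subset_Icc_self ht)).hasDerivAt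
      (Icc_mem_nhds ht.1 ht.2)).hasDerivWithinAt) hint
    (fun t ht => by
      have ht' := Set.Ioo_subset_Icc_self ht
      have h1 := abs_lt.mp (hlt t ht')
      have hp : 0 < 1 + φ t := by linarith
      have hm : 0 < 1 - φ t := by linarith
      rw [div_sub_div _ _ hp.ne' hm.ne', div_le_iff₀ (mul_pos hp hm)]
      linarith [hbound t ht'])
  have hφ0 : φ 0 = 0 := by
    rw [hφ]
    simp only [hγ.source, cayley_self hRR (transpose_eq_of_mem hZ₁) hRu, map_zero]
  have hφ1 : φ 1 = reForm a b (cayley R Z₁ Z₂) := by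
    rw [hφ]
    simp only [hγ.target]
  simp only [hφ0, hφ1, add_zero, sub_zero, Real.log_one] at hfinal
  refine ⟨hφ1 ▸ hlt 1 (by simp), hfinal⟩

theorem length_nonneg (γ : ℝ → Matrix (Fin d) (Fin d) ℂ) : 0 ≤ length γ :=
  intervalIntegral.integral_nonneg zero_le_one fun _ _ => finslerNorm_nonneg _ _

theorem log_norm_cayley_le_length (hR : Rᴴ = R)
    (hR2 : ∀ v, vecNorm (R *ᵥ v) ^ 2 = imForm Z₁ v) (hRR : R * R = imPart Z₁)
    (hRu : IsUnit R.det) (hZ₁ : Z₁ ∈ upperHalfSpace d)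
    {γ : ℝ → Matrix (Fin d) (Fin d) ℂ} (hγ : IsPath Z₁ Z₂ γ) :
    ‖cayley R Z₁ Z₂‖ < 1 ∧
    Real.log (1 + ‖cayley R Z₁ Z₂‖) - Real.log (1 - ‖cayley R Z₁ Z₂‖) ≤ length γ := by
  have hl := Real.one_le_exp (length_nonneg γ)
  set e := Real.exp (length γ) with he
  -- Solving `(1 + x) / (1 - x) ≤ e` for `x` gives a bound independent of `a` and `b`, so it passes
  -- to the operator norm.
  have hr : ‖cayley R Z₁ Z₂‖ ≤ (e - 1) / (e + 1) := by
    refine opNorm_le_of_re_le (div_nonneg (by linarith) (by linarith)) fun a b ha hb => ?_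
    obtain ⟨h1, h2⟩ := log_reForm_cayley_le_length hR hR2 hRR hRu hZ₁ hγ ha hb
    rw [reForm_apply] at h1 h2
    obtain ⟨h3, h4⟩ := abs_lt.mp h1
    rw [← Real.log_div (by linarith) (by linarith),
      Real.log_le_iff_le_exp (div_pos (by linarith) (by linarith)), ← he,
      div_le_iff₀ (by linarith)] at h2
    rw [le_div_iff₀ (by linarith)]
    linarith
  have h0 := norm_nonneg (cayley R Z₁ Z₂)
  rw [le_div_iff₀ (by linarith)] at hr
  have h1 : ‖cayley R Z₁ Z₂‖ < 1 := by nlinarith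
  refine ⟨h1, ?_⟩
  rw [← Real.log_div (by linarith) (by linarith),
      Real.log_le_iff_le_exp (div_pos (by linarith) (by linarith)), ← he,
      div_le_iff₀ (by linarith)]
  linarith

end Lower

/-! ### The inverse Cayley transform and segments through the centre of the ball. -/

/-- The inverse of the Cayley transform centred at `Z₁`. -/
def invCayley (R Z₁ G : Matrix (Fin d) (Fin d) ℂ) : Matrix (Fin d) (Fin d) ℂ :=
  Z₁ᴴ + (2 * Complex.I) • (R * (1 - G)⁻¹ * R)

section

variable {R Z₁ Z G : Matrix (Fin d) (Fin d) ℂ}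

theorem two_I_ne_zero : (2 * Complex.I) ≠ 0 := by simp

theorem inv_invCayley_sub (hRu : IsUnit R.det) (hG : IsUnit (1 - G)) :
    IsUnit (invCayley R Z₁ G - Z₁ᴴ) ∧ (invCayley R Z₁ G - Z₁ᴴ)⁻¹ =
      (2 * Complex.I)⁻¹ • (R⁻¹ * (1 - G) * R⁻¹) := by
  have hu := (Matrix.isUnit_iff_isUnit_det _).mp hG
  have h : (invCayley R Z₁ G - Z₁ᴴ) * ((2 * Complex.I)⁻¹ • (R⁻¹ * (1 - G) * R⁻¹)) = 1 := by
    rw [invCayley, add_sub_cancel_left, smul_mul_smul_comm, mul_inv_cancel₀ two_I_ne_zero,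
      one_smul]
    simp only [Matrix.mul_assoc]
    rw [mul_nonsing_inv_cancel_left _ _ hRu, nonsing_inv_mul_cancel_left _ _ hu,
      mul_nonsing_inv _ hRu]
  exact ⟨IsUnit.of_mul_eq_one _ h, inv_eq_right_inv h⟩

theorem cayley_invCayley (hRu : IsUnit R.det) (hG : IsUnit (1 - G)) :
    cayley R Z₁ (invCayley R Z₁ G) = G := by
  rw [cayley, (inv_invCayley_sub hRu hG).2, mul_smul_comm, smul_mul_assoc, smul_smul,
    mul_inv_cancel₀ two_I_ne_zero, one_smul, Matrix.mul_assoc, Matrix.mul_assoc,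
    nonsing_inv_mul _ hRu, Matrix.mul_one, mul_nonsing_inv_cancel_left _ _ hRu, sub_sub_cancel]

theorem one_sub_cayley : 1 - cayley R Z₁ Z = (2 * Complex.I) • (R * (Z - Z₁ᴴ)⁻¹ * R) := by
  rw [cayley, sub_sub_cancel]

theorem invCayley_cayley (hRu : IsUnit R.det) (hD : IsUnit (Z - Z₁ᴴ)) :
    invCayley R Z₁ (cayley R Z₁ Z) = Z := by
  have hu := (Matrix.isUnit_iff_isUnit_det _).mp hD
  have h : (1 - cayley R Z₁ Z)⁻¹ = (2 * Complex.I)⁻¹ • (R⁻¹ * (Z - Z₁ᴴ) * R⁻¹) := by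
    refine inv_eq_right_inv ?_
    rw [one_sub_cayley, smul_mul_smul_comm, mul_inv_cancel₀ two_I_ne_zero, one_smul]
    simp only [Matrix.mul_assoc]
    rw [mul_nonsing_inv_cancel_left _ _ hRu, nonsing_inv_mul_cancel_left _ _ hu,
      mul_nonsing_inv _ hRu]
  rw [invCayley, h, mul_smul_comm, smul_mul_assoc, smul_smul,
    mul_inv_cancel₀ two_I_ne_zero, one_smul, Matrix.mul_assoc, Matrix.mul_assoc,
    nonsing_inv_mul _ hRu, Matrix.mul_one, mul_nonsing_inv_cancel_left _ _ hRu, add_sub_cancel]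

theorem invCayley_zero (hRR : R * R = imPart Z₁) (hZ₁ : Z₁ᵀ = Z₁) : invCayley R Z₁ 0 = Z₁ := by
  rw [invCayley, sub_zero, inv_one, Matrix.mul_one, hRR, imPart_eq hZ₁, add_sub_cancel]

theorem transpose_conjTranspose_of_symm (hZ : Zᵀ = Z) : Zᴴᵀ = Zᴴ := by
  rw [conjTranspose, hZ, ← transpose_map, hZ]

theorem transpose_cayley (hRT : Rᵀ = R) (hZ₁ : Z₁ᵀ = Z₁) (hZ : Zᵀ = Z) :
    (cayley R Z₁ Z)ᵀ = cayley R Z₁ Z := by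
  rw [cayley, transpose_sub, transpose_one, transpose_smul, transpose_mul, transpose_mul,
    transpose_nonsing_inv, transpose_sub, hRT, hZ, transpose_conjTranspose_of_symm hZ₁,
    Matrix.mul_assoc]

theorem transpose_invCayley (hRT : Rᵀ = R) (hZ₁ : Z₁ᵀ = Z₁) (hG : Gᵀ = G) :
    (invCayley R Z₁ G)ᵀ = invCayley R Z₁ G := by
  rw [invCayley, transpose_add, transpose_smul, transpose_mul, transpose_mul,
    transpose_nonsing_inv, transpose_sub, transpose_one, hRT, hG,
    transpose_conjTranspose_of_symm hZ₁, Matrix.mul_assoc]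

theorem imForm_smul_vec (M : Matrix (Fin d) (Fin d) ℂ) (c : ℂ) (a : Fin d → ℂ) :
    imForm M (c • a) = ‖c‖ ^ 2 * imForm M a := by
  rw [imForm, mulVec_smul, dotProduct_smul, star_smul, smul_dotProduct, smul_eq_mul, smul_eq_mul,
    ← mul_assoc, Complex.star_def, Complex.mul_conj', ← Complex.ofReal_pow, Complex.im_ofReal_mul,
    imForm]

/-- The vector `R⁻¹ (1 - C) v`, with `C` the Cayley image, is `2i (Z - Z₁ᴴ)⁻¹ R v`, and `|2i|² = 4`
absorbs the factor. In this form the argument is affine in `C`. -/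
theorem vecNorm_cayley_mulVec' (hR : Rᴴ = R) (hR2 : ∀ v, vecNorm (R *ᵥ v) ^ 2 = imForm Z₁ v)
    (hRu : IsUnit R.det) (hD : IsUnit (Z - Z₁ᴴ)) (v : Fin d → ℂ) :
    vecNorm (cayley R Z₁ Z *ᵥ v) ^ 2 =
      vecNorm v ^ 2 - imForm Z (R⁻¹ *ᵥ (1 - cayley R Z₁ Z) *ᵥ v) := by
  have h : R⁻¹ *ᵥ (1 - cayley R Z₁ Z) *ᵥ v =
      (2 * Complex.I) • ((Z - Z₁ᴴ)⁻¹ *ᵥ R *ᵥ v) := by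
    rw [one_sub_cayley, smul_mulVec, mulVec_smul, mulVec_mulVec, mulVec_mulVec, Matrix.mul_assoc,
      nonsing_inv_mul_cancel_left _ _ hRu]
  rw [vecNorm_cayley_mulVec hR hR2 hD, h, imForm_smul_vec]
  norm_num

theorem vecNorm_cayley_conjTranspose_mulVec' (hR : Rᴴ = R)
    (hR2 : ∀ v, vecNorm (R *ᵥ v) ^ 2 = imForm Z₁ v)
    (hRu : IsUnit R.det) (hD : IsUnit (Z - Z₁ᴴ)) (v : Fin d → ℂ) :
    vecNorm ((cayley R Z₁ Z)ᴴ *ᵥ v) ^ 2 =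
      vecNorm v ^ 2 - imForm Z (R⁻¹ *ᵥ (1 - cayley R Z₁ Z)ᴴ *ᵥ v) := by
  have h : R⁻¹ *ᵥ (1 - cayley R Z₁ Z)ᴴ *ᵥ v =
      (-(2 * Complex.I)) • (((Z - Z₁ᴴ)⁻¹)ᴴ *ᵥ R *ᵥ v) := by
    rw [one_sub_cayley, conjTranspose_smul, conjTranspose_mul, conjTranspose_mul, hR, smul_mulVec,
      mulVec_smul, mulVec_mulVec, mulVec_mulVec, nonsing_inv_mul_cancel_left _ _ hRu]
    simp
  rw [vecNorm_cayley_conjTranspose_mulVec hR hR2 hD, h, imForm_smul_vec]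
  norm_num

theorem imForm_invCayley (hR : Rᴴ = R) (hR2 : ∀ v, vecNorm (R *ᵥ v) ^ 2 = imForm Z₁ v)
    (hRu : IsUnit R.det) (hG : IsUnit (1 - G)) (a : Fin d → ℂ) :
    imForm (invCayley R Z₁ G) a =
      vecNorm ((1 - G)⁻¹ *ᵥ R *ᵥ a) ^ 2 - vecNorm (G *ᵥ (1 - G)⁻¹ *ᵥ R *ᵥ a) ^ 2 := by
  have hu := (Matrix.isUnit_iff_isUnit_det _).mp hG
  have h := vecNorm_cayley_mulVec' hR hR2 hRu (inv_invCayley_sub (Z₁ := Z₁) hRu hG).1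
    ((1 - G)⁻¹ *ᵥ R *ᵥ a)
  have e : R⁻¹ *ᵥ (1 - G) *ᵥ (1 - G)⁻¹ *ᵥ R *ᵥ a = a := by
    rw [mulVec_mulVec (M := 1 - G), mul_nonsing_inv _ hu, one_mulVec, mulVec_mulVec,
      nonsing_inv_mul _ hRu, one_mulVec]
  rw [cayley_invCayley hRu hG, e] at h
  linarith

theorem imForm_invCayley' (hR : Rᴴ = R) (hR2 : ∀ v, vecNorm (R *ᵥ v) ^ 2 = imForm Z₁ v)
    (hRu : IsUnit R.det) (hG : IsUnit (1 - G)) (a : Fin d → ℂ) :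
    imForm (invCayley R Z₁ G) a =
      vecNorm (((1 - G)⁻¹)ᴴ *ᵥ R *ᵥ a) ^ 2 - vecNorm (Gᴴ *ᵥ ((1 - G)⁻¹)ᴴ *ᵥ R *ᵥ a) ^ 2 := by
  have hu := (Matrix.isUnit_iff_isUnit_det _).mp hG
  have h := vecNorm_cayley_conjTranspose_mulVec' hR hR2 hRu
    (inv_invCayley_sub (Z₁ := Z₁) hRu hG).1 (((1 - G)⁻¹)ᴴ *ᵥ R *ᵥ a)
  have e : R⁻¹ *ᵥ (1 - G)ᴴ *ᵥ ((1 - G)⁻¹)ᴴ *ᵥ R *ᵥ a = a := by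
    rw [mulVec_mulVec (M := (1 - G)ᴴ), ← conjTranspose_mul, nonsing_inv_mul _ hu,
      conjTranspose_one, one_mulVec, mulVec_mulVec, nonsing_inv_mul _ hRu, one_mulVec]
  rw [cayley_invCayley hRu hG, e] at h
  linarith

theorem norm_smul_lt_one {E : Matrix (Fin d) (Fin d) ℂ} (hE : ‖E‖ < 1) {t : ℝ}
    (ht : t ∈ Set.Icc (0 : ℝ) 1) : ‖t • E‖ < 1 := by
  rw [norm_smul, Real.norm_of_nonneg ht.1]
  nlinarith [norm_nonneg E, ht.1, ht.2]

/-- The set of matrices with imaginary part at least `y` is convex along the segments through the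
origin of the unit ball. -/
theorem le_imForm_invCayley (hR : Rᴴ = R) (hR2 : ∀ v, vecNorm (R *ᵥ v) ^ 2 = imForm Z₁ v)
    (hRu : IsUnit R.det) (hD : IsUnit (Z - Z₁ᴴ)) (hE : ‖cayley R Z₁ Z‖ < 1) {y : ℝ} (hy : 0 ≤ y)
    (hy₁ : ∀ a, y * vecNorm a ^ 2 ≤ imForm Z₁ a) (hy₂ : ∀ a, y * vecNorm a ^ 2 ≤ imForm Z a)
    {t : ℝ} (ht : t ∈ Set.Icc (0 : ℝ) 1) (a : Fin d → ℂ) :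
    y * vecNorm a ^ 2 ≤ imForm (invCayley R Z₁ (t • cayley R Z₁ Z)) a := by
  have hG := isUnit_one_sub_of_norm_lt_one (norm_smul_lt_one hE ht)
  have hGu := (Matrix.isUnit_iff_isUnit_det _).mp hG
  rw [imForm_invCayley hR hR2 hRu hG]
  set E := cayley R Z₁ Z with hEdef
  set p := (1 - t • E)⁻¹ *ᵥ R *ᵥ a with hp
  -- For fixed `p`, the vector `a` is affine in `t`, so the desired inequality is quadratic in `t`.
  have ha : a = R⁻¹ *ᵥ p - (t : ℂ) • (R⁻¹ *ᵥ E *ᵥ p) := by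
    have : R *ᵥ a = p - (t : ℂ) • (E *ᵥ p) := by
      have h : (1 - t • E) *ᵥ p = R *ᵥ a := by
        rw [hp, mulVec_mulVec, mul_nonsing_inv _ hGu, one_mulVec]
      rw [← h, sub_mulVec, one_mulVec, smul_mulVec]
      rfl
    rw [← mulVec_smul, ← mulVec_sub, ← this, mulVec_mulVec, nonsing_inv_mul _ hRu, one_mulVec]
  clear_value p
  have h0 := hy₁ (R⁻¹ *ᵥ p)
  rw [← hR2, mulVec_mulVec, mul_nonsing_inv _ hRu, one_mulVec] at h0
  have h1 := hy₂ (R⁻¹ *ᵥ (1 - E) *ᵥ p)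
  have h2 := vecNorm_cayley_mulVec' hR hR2 hRu hD p
  rw [← hEdef] at h2
  have h3 : imForm Z (R⁻¹ *ᵥ (1 - E) *ᵥ p) = vecNorm p ^ 2 - vecNorm (E *ᵥ p) ^ 2 := by
    linarith
  rw [h3, sub_mulVec, one_mulVec, mulVec_sub, vecNorm_sub_sq] at h1
  have h4 : vecNorm ((t • E) *ᵥ p) ^ 2 = t ^ 2 * vecNorm (E *ᵥ p) ^ 2 := by
    have : (t • E) *ᵥ p = (t : ℂ) • (E *ᵥ p) := by rw [smul_mulVec]; rfl
    rw [this, vecNorm_smul, mul_pow, Complex.norm_real, Real.norm_eq_abs, sq_abs]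
  have h5 : vecNorm a ^ 2 = vecNorm (R⁻¹ *ᵥ p) ^ 2 -
      2 * (t * (star (R⁻¹ *ᵥ p) ⬝ᵥ R⁻¹ *ᵥ E *ᵥ p).re) +
      t ^ 2 * vecNorm (R⁻¹ *ᵥ E *ᵥ p) ^ 2 := by
    rw [ha, vecNorm_sub_sq, vecNorm_smul, mul_pow, Complex.norm_real, Real.norm_eq_abs, sq_abs,
      dotProduct_smul, smul_eq_mul, Complex.re_ofReal_mul]
  rw [h4, h5]
  -- The difference of the two sides is concave in `t`. It is nonnegative at `t = 0` by `h0` and at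
  -- `t = 1` by `h1`; this term is its excess over the chord.
  have h6 : 0 ≤ t * (1 - t) * (y * vecNorm (R⁻¹ *ᵥ E *ᵥ p) ^ 2 + vecNorm (E *ᵥ p) ^ 2) :=
    mul_nonneg (mul_nonneg ht.1 (sub_nonneg.mpr ht.2))
      (add_nonneg (mul_nonneg hy (sq_nonneg _)) (sq_nonneg _))
  linarith [mul_le_mul_of_nonneg_left h0 (sub_nonneg.mpr ht.2), mul_le_mul_of_nonneg_left h1 ht.1]

theorem finslerNorm_invCayley_le (hR : Rᴴ = R) (hR2 : ∀ v, vecNorm (R *ᵥ v) ^ 2 = imForm Z₁ v)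
    (hRu : IsUnit R.det) {E : Matrix (Fin d) (Fin d) ℂ} (hE : ‖E‖ < 1)
    {t : ℝ} (ht : t ∈ Set.Icc (0 : ℝ) 1) (hmem : invCayley R Z₁ (t • E) ∈ upperHalfSpace d) :
    finslerNorm (invCayley R Z₁ (t • E))
        ((2 * Complex.I) • (R * ((1 - t • E)⁻¹ * E * (1 - t • E)⁻¹) * R)) ≤
      2 * ‖E‖ / (1 - t ^ 2 * ‖E‖ ^ 2) := by
  have hG := isUnit_one_sub_of_norm_lt_one (norm_smul_lt_one hE ht)
  have hnorm : ‖t • E‖ = t * ‖E‖ := by rw [norm_smul, Real.norm_of_nonneg ht.1]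
  have hlt := norm_smul_lt_one hE ht
  have hE0 := norm_nonneg E
  have hc : 0 < 1 - t ^ 2 * ‖E‖ ^ 2 := by
    rw [hnorm] at hlt
    nlinarith [mul_nonneg ht.1 hE0]
  refine finslerNorm_le hmem (by positivity) fun a b => ?_
  set G := t • E
  set α := ((1 - G)⁻¹)ᴴ *ᵥ R *ᵥ a with hα
  set β := (1 - G)⁻¹ *ᵥ R *ᵥ b with hβ
  have e : star a ⬝ᵥ ((2 * Complex.I) • (R * ((1 - G)⁻¹ * E * (1 - G)⁻¹) * R)) *ᵥ b =
      (2 * Complex.I) * (star α ⬝ᵥ E *ᵥ β) := by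
    simp only [α, β, smul_mulVec, dotProduct_smul, smul_eq_mul, star_mulVec_dotProduct,
        conjTranspose_mul, conjTranspose_conjTranspose, hR, mulVec_mulVec, Matrix.mul_assoc]
  have h1 : ‖star α ⬝ᵥ E *ᵥ β‖ ≤ ‖E‖ * (vecNorm α * vecNorm β) := by
    refine (norm_star_dotProduct_le _ _).trans ?_
    rw [mul_left_comm]
    exact mul_le_mul_of_nonneg_left (vecNorm_mulVec_le _ _) (vecNorm_nonneg _)
  -- Applied to `Gᴴ` at `α` and to `G` at `β`, this bounds the imaginary forms below by the
  -- Euclidean norms, giving the hyperbolic speed.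
  have sq_le : ∀ (M : Matrix (Fin d) (Fin d) ℂ) (v : Fin d → ℂ), ‖M‖ = t * ‖E‖ →
      (1 - t ^ 2 * ‖E‖ ^ 2) * vecNorm v ^ 2 ≤ vecNorm v ^ 2 - vecNorm (M *ᵥ v) ^ 2 :=
    fun M v hM => by
      have h := pow_le_pow_left₀ (vecNorm_nonneg _) (vecNorm_mulVec_le M v) 2
      rw [hM] at h
      linarith
  have ha : vecNorm α * √(1 - t ^ 2 * ‖E‖ ^ 2) ≤ √(imForm (invCayley R Z₁ G) a) := by
    refine Real.le_sqrt_of_sq_le ?_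
    rw [mul_pow, Real.sq_sqrt hc.le, imForm_invCayley' hR hR2 hRu hG, mul_comm]
    exact sq_le _ _ (by rw [Matrix.l2_opNorm_conjTranspose, hnorm])
  have hb : vecNorm β * √(1 - t ^ 2 * ‖E‖ ^ 2) ≤ √(imForm (invCayley R Z₁ G) b) := by
    refine Real.le_sqrt_of_sq_le ?_
    rw [mul_pow, Real.sq_sqrt hc.le, imForm_invCayley hR hR2 hRu hG, mul_comm]
    exact sq_le _ _ hnorm
  have hab : vecNorm α * vecNorm β * (1 - t ^ 2 * ‖E‖ ^ 2) ≤
      √(imForm (invCayley R Z₁ G) a) * √(imForm (invCayley R Z₁ G) b) := by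
    have h := mul_le_mul ha hb (mul_nonneg (vecNorm_nonneg _) (Real.sqrt_nonneg _))
      (Real.sqrt_nonneg _)
    rwa [mul_mul_mul_comm, Real.mul_self_sqrt hc.le] at h
  rw [e, norm_mul, mul_assoc, div_mul_eq_mul_div, le_div_iff₀ hc]
  have h2 : ‖(2 * Complex.I)‖ = 2 := by simp
  rw [h2]
  calc 2 * ‖star α ⬝ᵥ E *ᵥ β‖ * (1 - t ^ 2 * ‖E‖ ^ 2)
      ≤ 2 * (‖E‖ * (vecNorm α * vecNorm β)) * (1 - t ^ 2 * ‖E‖ ^ 2) := by gcongr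
    _ = 2 * ‖E‖ * (vecNorm α * vecNorm β * (1 - t ^ 2 * ‖E‖ ^ 2)) := by ring
    _ ≤ _ := by gcongr

end

theorem hasDerivWithinAt_invCayley {R Z₁ E : Matrix (Fin d) (Fin d) ℂ} {t : ℝ}
    (hG : IsUnit (1 - t • E)) :
    HasDerivWithinAt (fun t : ℝ => invCayley R Z₁ (t • E))
      ((2 * Complex.I) • (R * ((1 - t • E)⁻¹ * E * (1 - t • E)⁻¹) * R)) (Set.Icc 0 1) t := by
  have h1 : HasDerivWithinAt (fun t : ℝ => 1 - t • E) (-E) (Set.Icc 0 1) t := by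
    simpa using (((hasDerivAt_id t).smul_const E).const_sub 1).hasDerivWithinAt
  have h2 := (((hasDerivWithinAt_inv h1 hG).const_mul R).mul_const R).const_smul (2 * Complex.I)
  simpa [invCayley] using h2.const_add Z₁ᴴ

/-- A primitive of `2 r / (1 - t² r²)` is `log (1 + t r) - log (1 - t r)`. At `t = 1` it matches the
lower bound for arbitrary paths. -/
theorem integral_speed_le {r : ℝ} (h0 : 0 ≤ r) (h1 : r < 1) {φ : ℝ → ℝ} {c : ℝ}
    (hφ : MeasureTheory.IntegrableOn φ (Set.Icc 0 1))
    (h : ∀ t ∈ Set.Icc (0 : ℝ) 1, φ t ≤ c * (2 * r / (1 - t ^ 2 * r ^ 2))) :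
    ∫ t in (0 : ℝ)..1, φ t ≤ c * (Real.log (1 + r) - Real.log (1 - r)) := by
  have hpos : ∀ t ∈ Set.Icc (0 : ℝ) 1, 0 < 1 + t * r ∧ 0 < 1 - t * r := fun t ht =>
    ⟨by nlinarith [mul_nonneg ht.1 h0], by nlinarith [ht.1, ht.2]⟩
  have hd : ∀ t ∈ Set.Icc (0 : ℝ) 1,
      HasDerivAt (fun t => c * (Real.log (1 + t * r) - Real.log (1 - t * r)))
        (c * (2 * r / (1 - t ^ 2 * r ^ 2))) t := fun t ht => by
    obtain ⟨hp, hm⟩ := hpos t ht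
    have h2 : HasDerivAt (fun t : ℝ => t * r) r t := by
      simpa using (hasDerivAt_id t).mul_const r
    have h3 := (((h2.const_add 1).log hp.ne').sub ((h2.const_sub 1).log hm.ne')).const_mul c
    refine h3.congr_deriv ?_
    have : 1 - t ^ 2 * r ^ 2 = (1 + t * r) * (1 - t * r) := by ring
    rw [this, div_sub_div _ _ hp.ne' hm.ne']
    ring
  have := intervalIntegral.integral_le_sub_of_hasDeriv_right_of_le zero_le_one
    (fun t ht => (hd t ht).continuousAt.continuousWithinAt)
    (fun t ht => (hd t (Set.Ioo_subset_Icc_self ht)).hasDerivWithinAt) hφ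
    (fun t ht => h t (Set.Ioo_subset_Icc_self ht))
  simpa using this

/-! ### Contraction of the distance by one transfer map. -/

section Transfer

variable {z : ℂ} {B : Matrix (Fin d) (Fin d) ℂ}

/-- The term `-Z⁻¹` only adds to the imaginary part. One transfer step thus reaches the region where
the contraction holds. -/
theorem le_imForm_sub_inv {Z : Matrix (Fin d) (Fin d) ℂ} (hB : Bᴴ = B)
    (hZ : Z ∈ upperHalfSpace d) (a : Fin d → ℂ) :
    z.im * vecNorm a ^ 2 ≤ imForm (z • (1 : Matrix (Fin d) (Fin d) ℂ) - B - Z⁻¹) a := by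
  rw [imForm_flt hB, imForm_inv (isUnit_of_mem hZ)]
  linarith [imForm_nonneg hZ (Z⁻¹ *ᵥ a)]

theorem sub_inv_mem {Z : Matrix (Fin d) (Fin d) ℂ} (hz : 0 < z.im) (hB : Bᴴ = B) (hBT : Bᵀ = B)
    (hZ : Z ∈ upperHalfSpace d) :
    z • (1 : Matrix (Fin d) (Fin d) ℂ) - B - Z⁻¹ ∈ upperHalfSpace d := by
  refine mem_upperHalfSpace ?_ fun a ha => ?_
  · rw [transpose_sub, transpose_sub, transpose_smul, transpose_one, hBT, transpose_nonsing_inv,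
      transpose_eq_of_mem hZ]
  · exact (mul_pos hz (pow_pos (vecNorm_pos ha) 2)).trans_le (le_imForm_sub_inv hB hZ a)

/-- The image of the geodesic from `W₁` to `W₂` joins the images of its end points and is shorter
than any path from `W₁` to `W₂` by the factor `1 / (1 + y ^ 2)`. -/
theorem exists_isPath_length_le (hz : 0 < z.im) (hB : Bᴴ = B) (hBT : Bᵀ = B)
    {W₁ W₂ : Matrix (Fin d) (Fin d) ℂ} (h₁ : W₁ ∈ upperHalfSpace d) (h₂ : W₂ ∈ upperHalfSpace d)
    (hy₁ : ∀ a, z.im * vecNorm a ^ 2 ≤ imForm W₁ a)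
    (hy₂ : ∀ a, z.im * vecNorm a ^ 2 ≤ imForm W₂ a) :
    ∃ σ, IsPath (z • (1 : Matrix (Fin d) (Fin d) ℂ) - B - W₁⁻¹)
        (z • (1 : Matrix (Fin d) (Fin d) ℂ) - B - W₂⁻¹) σ ∧
      ∀ γ, IsPath W₁ W₂ γ → length σ ≤ 1 / (1 + z.im ^ 2) * length γ := by
  have hT₁ := transpose_eq_of_mem h₁
  have hT₂ := transpose_eq_of_mem h₂
  obtain ⟨R, hR, hRT, hR2, hRR, hRu⟩ : ∃ R : Matrix (Fin d) (Fin d) ℂ, Rᴴ = R ∧ Rᵀ = R ∧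
      (∀ v, vecNorm (R *ᵥ v) ^ 2 = imForm W₁ v) ∧ R * R = imPart W₁ ∧ IsUnit R.det := by
    refine ⟨CFC.sqrt (imPart W₁), conjTranspose_sqrt _,
      transpose_sqrt (imPart_posDef h₁).posSemidef ?_, fun v => ?_, sqrt_imPart_sq h₁,
      (Matrix.isUnit_iff_isUnit_det _).mp (isUnit_sqrt_imPart h₁)⟩
    · rw [imPart, ← transpose_map, h₁.2.1]
    · rw [vecNorm_sqrt_mulVec h₁, Real.sq_sqrt (imForm_nonneg h₁ v)]
  have hD := isUnit_sub_conjTranspose h₁ h₂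
  have hlow := fun γ (hγ : IsPath W₁ W₂ γ) => log_norm_cayley_le_length hR hR2 hRR hRu h₁ hγ
  -- Any path serves here: it is needed only to extract `‖E‖ < 1`.
  obtain ⟨γ₀, hγ₀⟩ := exists_isPath h₁ h₂
  have hE := (hlow γ₀ hγ₀).1
  set E := cayley R W₁ W₂ with hEdef
  set τ : ℝ → Matrix (Fin d) (Fin d) ℂ := fun t => invCayley R W₁ (t • E) with hτ
  set τ' : ℝ → Matrix (Fin d) (Fin d) ℂ := fun t =>
    (2 * Complex.I) • (R * ((1 - t • E)⁻¹ * E * (1 - t • E)⁻¹) * R) with hτ'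
  set σ : ℝ → Matrix (Fin d) (Fin d) ℂ := fun t =>
    z • (1 : Matrix (Fin d) (Fin d) ℂ) - B - (τ t)⁻¹ with hσ
  have hG : ∀ t ∈ Set.Icc (0 : ℝ) 1, IsUnit (1 - t • E) := fun t ht =>
    isUnit_one_sub_of_norm_lt_one (norm_smul_lt_one hE ht)
  have hτy : ∀ t ∈ Set.Icc (0 : ℝ) 1, ∀ a, z.im * vecNorm a ^ 2 ≤ imForm (τ t) a := fun t ht a =>
    le_imForm_invCayley hR hR2 hRu hD hE hz.le hy₁ hy₂ ht a
  have hτmem : ∀ t ∈ Set.Icc (0 : ℝ) 1, τ t ∈ upperHalfSpace d := fun t ht => by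
    refine mem_upperHalfSpace (transpose_invCayley hRT hT₁ ?_) fun a ha =>
      (mul_pos hz (pow_pos (vecNorm_pos ha) 2)).trans_le (hτy t ht a)
    rw [transpose_smul, transpose_cayley hRT hT₁ hT₂]
  have hτd : ∀ t ∈ Set.Icc (0 : ℝ) 1, HasDerivWithinAt τ (τ' t) (Set.Icc 0 1) t := fun t ht =>
    hasDerivWithinAt_invCayley (hG t ht)
  have hσmem : ∀ t ∈ Set.Icc (0 : ℝ) 1, σ t ∈ upperHalfSpace d := fun t ht =>
    sub_inv_mem hz hB hBT (hτmem t ht)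
  have hinv : ∀ t ∈ Set.Icc (0 : ℝ) 1, HasDerivWithinAt (fun t => (τ t)⁻¹)
      (-((τ t)⁻¹ * τ' t * (τ t)⁻¹)) (Set.Icc 0 1) t := fun t ht =>
    hasDerivWithinAt_inv (hτd t ht) (isUnit_of_mem (hτmem t ht))
  have hσd : ∀ t ∈ Set.Icc (0 : ℝ) 1, HasDerivWithinAt σ ((τ t)⁻¹ * τ' t * (τ t)⁻¹)
      (Set.Icc 0 1) t := fun t ht => by
    simpa using (hinv t ht).const_sub (z • (1 : Matrix (Fin d) (Fin d) ℂ) - B)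
  have hσd' : ∀ t ∈ Set.Icc (0 : ℝ) 1,
      derivWithin σ (Set.Icc 0 1) t = (τ t)⁻¹ * τ' t * (τ t)⁻¹ := fun t ht =>
    (hσd t ht).derivWithin (uniqueDiffOn_Icc zero_lt_one t ht)
  have hGc : ContinuousOn (fun t : ℝ => (1 - t • E)⁻¹) (Set.Icc 0 1) := fun t ht => by
    have h : HasDerivWithinAt (fun t : ℝ => 1 - t • E) (-E) (Set.Icc 0 1) t := by
      simpa using (((hasDerivAt_id t).smul_const E).const_sub 1).hasDerivWithinAt
    exact (hasDerivWithinAt_inv h (hG t ht)).continuousWithinAt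
  have hτ'c : ContinuousOn τ' (Set.Icc 0 1) :=
    (((continuousOn_const (c := R)).mul ((hGc.mul (continuousOn_const (c := E))).mul hGc)).mul
      (continuousOn_const (c := R))).const_smul (2 * Complex.I)
  have hinvc : ContinuousOn (fun t => (τ t)⁻¹) (Set.Icc 0 1) := fun t ht =>
    (hinv t ht).continuousWithinAt
  have hSc : ContinuousOn (fun t => invSqrtIm (σ t)) (Set.Icc 0 1) :=
    continuousOn_invSqrtIm.comp (fun t ht => (hσd t ht).continuousWithinAt) hσmem
  have hFc : ContinuousOn (fun t => finslerNorm (σ t) (derivWithin σ (Set.Icc 0 1) t))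
      (Set.Icc 0 1) :=
    ((hSc.mul ((hinvc.mul hτ'c).mul hinvc)).mul hSc).norm.congr fun t ht => by
      simp only [finslerNorm, hσd' t ht]; rfl
  refine ⟨σ, ⟨?_, ?_, hσmem, fun t ht => (hσd t ht).differentiableWithinAt, ?_⟩, fun γ hγ => ?_⟩
  · simp only [hσ, hτ, zero_smul, invCayley_zero hRR hT₁]
  · simp only [hσ, hτ, one_smul, hEdef, invCayley_cayley hRu hD]
  · apply ContinuousOn.intervalIntegrable
    rwa [Set.uIcc_of_le zero_le_one]
  · refine (integral_speed_le (norm_nonneg E) hE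
      (c := 1 / (1 + z.im ^ 2)) (hFc.integrableOn_compact isCompact_Icc) fun t ht => ?_).trans ?_
    · rw [hσd' t ht]
      exact (finslerNorm_sub_inv_le hz hB (hτmem t ht) (hτy t ht) (hσmem t ht) (τ' t)).trans
        (mul_le_mul_of_nonneg_left (finslerNorm_invCayley_le hR hR2 hRu hE ht (hτmem t ht))
          (by positivity))
    · exact mul_le_mul_of_nonneg_left (hlow γ hγ).2 (by positivity)

/-- The single path `σ` bounds the left side and is compared with all `γ`, so the infimum over `γ`
may be taken afterwards. -/
theorem dInf_sub_inv_le (hz : 0 < z.im) (hB : Bᴴ = B) (hBT : Bᵀ = B)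
    {W₁ W₂ : Matrix (Fin d) (Fin d) ℂ} (h₁ : W₁ ∈ upperHalfSpace d) (h₂ : W₂ ∈ upperHalfSpace d)
    (hy₁ : ∀ a, z.im * vecNorm a ^ 2 ≤ imForm W₁ a)
    (hy₂ : ∀ a, z.im * vecNorm a ^ 2 ≤ imForm W₂ a) :
    dInf (z • (1 : Matrix (Fin d) (Fin d) ℂ) - B - W₁⁻¹)
        (z • (1 : Matrix (Fin d) (Fin d) ℂ) - B - W₂⁻¹) ≤
      1 / (1 + z.im ^ 2) * dInf W₁ W₂ := by
  obtain ⟨σ, hσ, hle⟩ := exists_isPath_length_le hz hB hBT h₁ h₂ hy₁ hy₂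
  have hc : 0 < 1 / (1 + z.im ^ 2) := by positivity
  have h1 : dInf (z • (1 : Matrix (Fin d) (Fin d) ℂ) - B - W₁⁻¹)
      (z • (1 : Matrix (Fin d) (Fin d) ℂ) - B - W₂⁻¹) ≤ length σ := by
    refine csInf_le ⟨0, ?_⟩ ⟨σ, hσ, rfl⟩
    rintro _ ⟨γ, -, rfl⟩
    exact length_nonneg γ
  refine h1.trans ?_
  rw [mul_comm, ← div_le_iff₀ hc]
  obtain ⟨γ₀, hγ₀⟩ := exists_isPath h₁ h₂
  refine le_csInf ⟨_, γ₀, hγ₀, rfl⟩ ?_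
  rintro _ ⟨γ, hγ, rfl⟩
  rw [div_le_iff₀ hc, mul_comm]
  exact hle γ hγ

end Transfer

theorem fltDenom_transferMinus (B : ℕ → Matrix (Fin d) (Fin d) ℝ) (n : ℕ) (z : ℂ)
    (Z : Matrix (Fin d) (Fin d) ℂ) : fltDenom (transferMinus B n z) Z = Z := by
  simp [fltDenom, transferMinus]

theorem flt_transferMinus (B : ℕ → Matrix (Fin d) (Fin d) ℝ) (n : ℕ) (z : ℂ)
    {Z : Matrix (Fin d) (Fin d) ℂ} (hZ : IsUnit Z) :
    flt (transferMinus B n z) Z =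
      z • (1 : Matrix (Fin d) (Fin d) ℂ) - (B n).map Complex.ofReal - Z⁻¹ := by
  have hu := (Matrix.isUnit_iff_isUnit_det _).mp hZ
  rw [flt, fltDenom_transferMinus, transferMinus, toBlocks_fromBlocks₁₁, toBlocks_fromBlocks₁₂,
    add_mul, mul_nonsing_inv_cancel_right _ _ hu, neg_one_mul, ← sub_eq_add_neg]

end Siegel

end

open Siegel in
theorem mainTheorem1 (d : ℕ) (B : ℕ → Matrix (Fin d) (Fin d) ℝ) (hB : ∀ n, (B n)ᵀ = B n)
    (z : ℂ) (hz : 0 < z.im)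
    (Z₁ Z₂ : Matrix (Fin d) (Fin d) ℂ)
    (hZ₁ : Z₁ ∈ Siegel.upperHalfSpace d) (hZ₂ : Z₂ ∈ Siegel.upperHalfSpace d)
    (W₁ W₂ : Matrix (Fin d) (Fin d) ℂ)
    (hW₁ : W₁ = Siegel.flt (Siegel.transferMinus B 0 z) Z₁)
    (hW₂ : W₂ = Siegel.flt (Siegel.transferMinus B 0 z) Z₂) :
    (IsUnit (Siegel.fltDenom (Siegel.transferMinus B 0 z) Z₁) ∧
      IsUnit (Siegel.fltDenom (Siegel.transferMinus B 0 z) Z₂) ∧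
      W₁ ∈ Siegel.upperHalfSpace d ∧ W₂ ∈ Siegel.upperHalfSpace d) ∧
    ∀ n : ℕ,
      (IsUnit (Siegel.fltDenom (Siegel.transferMinus B n z) W₁) ∧
        IsUnit (Siegel.fltDenom (Siegel.transferMinus B n z) W₂) ∧
        Siegel.flt (Siegel.transferMinus B n z) W₁ ∈ Siegel.upperHalfSpace d ∧
        Siegel.flt (Siegel.transferMinus B n z) W₂ ∈ Siegel.upperHalfSpace d) ∧
      Siegel.dInf (Siegel.flt (Siegel.transferMinus B n z) W₁)
          (Siegel.flt (Siegel.transferMinus B n z) W₂) ≤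
        1 / (1 + z.im ^ 2) * Siegel.dInf W₁ W₂ := by
  have hBT : ∀ n, ((B n).map Complex.ofReal)ᵀ = (B n).map Complex.ofReal := fun n => by
    rw [← transpose_map, hB n]
  have hBH : ∀ n, ((B n).map Complex.ofReal)ᴴ = (B n).map Complex.ofReal := fun n => by
    rw [conjTranspose, hBT n]
    ext i j
    simp
  have hu₁ := isUnit_of_mem hZ₁
  have hu₂ := isUnit_of_mem hZ₂
  rw [flt_transferMinus B 0 z hu₁] at hW₁
  rw [flt_transferMinus B 0 z hu₂] at hW₂
  have hm₁ : W₁ ∈ upperHalfSpace d := hW₁ ▸ sub_inv_mem hz (hBH 0) (hBT 0) hZ₁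
  have hm₂ : W₂ ∈ upperHalfSpace d := hW₂ ▸ sub_inv_mem hz (hBH 0) (hBT 0) hZ₂
  have hv₁ := isUnit_of_mem hm₁
  have hv₂ := isUnit_of_mem hm₂
  simp only [fltDenom_transferMinus]
  refine ⟨⟨hu₁, hu₂, hm₁, hm₂⟩, fun n => ?_⟩
  rw [flt_transferMinus B n z hv₁, flt_transferMinus B n z hv₂]
  refine ⟨⟨hv₁, hv₂, sub_inv_mem hz (hBH n) (hBT n) hm₁, sub_inv_mem hz (hBH n) (hBT n) hm₂⟩,
    dInf_sub_inv_le hz (hBH n) (hBT n) hm₁ hm₂ (fun a => ?_) fun a => ?_⟩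
  -- The lower bound on the imaginary part comes from the step with `B 0`, whichever `n` is applied
  -- next.
  · rw [hW₁]; exact le_imForm_sub_inv (hBH 0) hZ₁ a
  · rw [hW₂]; exact le_imForm_sub_inv (hBH 0) hZ₂ a
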